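/- Let $D\subset\mathbb R^n$ be open, let $f:D\to\mathbb R^n$ be a vector field of class $C^r$, where $1\le r\le\infty$ or $r=\omega$ (real analytic), and assume that every solution of $\dot x=f(x)$ starting in $D$ exists and stays in $D$ for all times, so that the flow $\varphi_t$ is defined on $D$ for all $t\in\mathbb R$. Let $\gamma:\mathbb R\to D$ be a periodic solution of period $T>0$, put $x_0=\gamma(0)$, and let $\Sigma=x_0+V$ be a hyperplane ($V\subset\mathbb R^n$ a linear subspace of dimension $n-1$) that is transverse to the orbit at $x_0$, i.e. $\dot\gamma(0)\notin V$. A Poincaré map of the orbit is a map $\Pi$ defined near $0$ in $V$ by $x_0+\Pi(y)=\varphi_{\tau(y)}(x_0+y)$, where $\tau$ is continuous near $0$, $\tau(0)=T$, and, for some neighbourhood $W$ of $x_0$ in $\mathbb R^n$ and all $y\in V$ close to $0$, $\tau(y)$ is the smallest $t>0$ with $\varphi_t(x_0+y)\in\Sigma\cap W$. The characteristic multipliers of the orbit are the complex eigenvalues, counted with algebraic multiplicity, of the monodromy matrix $U(T)$, where $U$ is the principal solution of the linearized equation: $\dot U(t)=\frac{\partial f}{\partial x}(\gamma(t))\,U(t)$,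 $U(0)=\mathbf 1$. Then the principal solution $U$ exists for all times; if $T$ is the least period of the orbit (i.e. $\varphi_t(x_0)\ne x_0$ for $0<t<T$), a Poincaré map exists; and for every Poincaré map $\Pi$: 1. $\Pi$ is of class $C^r$ in a neighbourhood of $0$; 2. $\Pi(0)=0$, and the characteristic multipliers of the orbit are $1$ together with the $n-1$ complex eigenvalues (counted with algebraic multiplicity) of the Jacobian matrix $\frac{\partial\Pi}{\partial y}(0):V\to V$. -/

import Mathlib

open Set Filter Topology

noncomputable section

/-- `φ` is the flow of `ẋ = f x` on the phase space `D`: for every `x ∈ D`, `t ↦ φ t x` is a solution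
defined for all times, with values in `D` and initial value `x`. Nothing is said of `φ` outside
`D`. When `f` is `C¹` on the open set `D`, solutions are unique and `φ` is determined on `D`. -/
structure IsFlowOn {n : ℕ} (f : EuclideanSpace ℝ (Fin n) → EuclideanSpace ℝ (Fin n))
    (D : Set (EuclideanSpace ℝ (Fin n)))
    (φ : ℝ → EuclideanSpace ℝ (Fin n) → EuclideanSpace ℝ (Fin n)) : Prop where
  zero : ∀ x ∈ D, φ 0 x = x
  mem : ∀ x ∈ D, ∀ t, φ t x ∈ D
  isIntegralCurve : ∀ x ∈ D, IsIntegralCurve (fun t => φ t x) (fun _ => f)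

/-- `γ` is a periodic solution of period `T` of `ẋ = f x` in the phase space `D`. -/
structure IsPeriodicSolution {n : ℕ} (f : EuclideanSpace ℝ (Fin n) → EuclideanSpace ℝ (Fin n))
    (D : Set (EuclideanSpace ℝ (Fin n))) (γ : ℝ → EuclideanSpace ℝ (Fin n)) (T : ℝ) : Prop where
  pos : 0 < T
  mem : ∀ t, γ t ∈ D
  isIntegralCurve : IsIntegralCurve γ (fun _ => f)
  periodic : ∀ t, γ (t + T) = γ t

/-- `T` is the least period of the orbit of the point `x₀` (for a flow `φ` with `φ T x₀ = x₀`). -/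
def IsLeastPeriod {n : ℕ} (φ : ℝ → EuclideanSpace ℝ (Fin n) → EuclideanSpace ℝ (Fin n))
    (x₀ : EuclideanSpace ℝ (Fin n)) (T : ℝ) : Prop :=
  ∀ t, 0 < t → t < T → φ t x₀ ≠ x₀

/-- The affine hyperplane `γ 0 + V`, with `V` a linear subspace of codimension one, is transverse
to the curve `γ` at the point `γ 0`. -/
structure IsTransverseHyperplane {n : ℕ} (γ : ℝ → EuclideanSpace ℝ (Fin n))
    (V : Submodule ℝ (EuclideanSpace ℝ (Fin n))) : Prop where
  finrank_add_one : Module.finrank ℝ V + 1 = n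
  transverse : deriv γ 0 ∉ V

/-- `U` is the principal solution of the linear equation `ẏ = A t y`. -/
structure IsPrincipalSolution {n : ℕ}
    (A U : ℝ → EuclideanSpace ℝ (Fin n) →L[ℝ] EuclideanSpace ℝ (Fin n)) : Prop where
  zero : U 0 = ContinuousLinearMap.id ℝ (EuclideanSpace ℝ (Fin n))
  hasDerivAt : ∀ t, HasDerivAt U (A t ∘L U t) t

/-- The complex eigenvalues of a real linear endomorphism, with algebraic multiplicities. -/
def complexEigenvalues {V : Type*} [AddCommGroup V] [Module ℝ V] [FiniteDimensional ℝ V]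
    (L : V →ₗ[ℝ] V) : Multiset ℂ :=
  (L.charpoly.map (algebraMap ℝ ℂ)).roots

/-- `P : V → V` is a Poincaré map, with return time `τ`, of the orbit of `x₀` of period `T`, for the
hyperplane `x₀ + V`. Only the values of `P` and `τ` near `0` matter: there are a neighbourhood `N`
of `0` in `V` and a vicinity `W` of `x₀` such that `τ` is continuous on `N` with `τ 0 = T` and, for
`y ∈ N`, the orbit of `x₀ + y` returns for the first time to `(x₀ + V) ∩ W` at time `τ y`, at the
point `x₀ + P y`. -/
def IsPoincareMap {n : ℕ} (φ : ℝ → EuclideanSpace ℝ (Fin n) → EuclideanSpace ℝ (Fin n))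
    (D : Set (EuclideanSpace ℝ (Fin n))) (x₀ : EuclideanSpace ℝ (Fin n)) (T : ℝ)
    (V : Submodule ℝ (EuclideanSpace ℝ (Fin n))) (τ : V → ℝ) (P : V → V) : Prop :=
  ∃ N ∈ 𝓝 (0 : V), ∃ W ∈ 𝓝 x₀,
    ContinuousOn τ N ∧ τ 0 = T ∧
    ∀ y ∈ N, x₀ + (y : EuclideanSpace ℝ (Fin n)) ∈ D ∧
      IsLeast {t : ℝ | 0 < t ∧ φ t (x₀ + y) - x₀ ∈ V ∧ φ t (x₀ + y) ∈ W} (τ y) ∧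
      x₀ + (P y : EuclideanSpace ℝ (Fin n)) = φ (τ y) (x₀ + y)

end

/-!
The argument rests on smooth dependence of the flow on time and initial value, for every class `C^r`
including the analytic one. After rescaling time, the orbit of `x` on `[0, s]` is a zero `α` of
`α - x - s ∫ f ∘ α` in the Banach space of continuous curves on the unit interval. Composition with
`f` is as smooth on that space as `f` is: for finite `r` because its derivative is again of this
type (`contDiffOn_superposition`), in the analytic case, near constant curves, because the power
series of `f` can be applied pointwise (`analyticAt_superposition_const`). At `s = 0` the derivative
with respect to `α` is the identity, so that the implicit function theorem makes the flow `C^r` near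
time `0` (`IsFlowOn.contDiffAt_zero`); the group property propagates this to all times
(`IsFlowOn.contDiffAt_of_ne_infty`), and the class `C^∞` is the intersection of the finite ones.

The spatial derivative of the flow along the orbit solves the linearized equation
(`IsFlowOn.isPrincipalSolution_fderiv`); hence the principal solution exists, and by uniqueness the
monodromy operator is the derivative of the time-`T` map.

Choose a functional `ℓ` with kernel `V` and `ℓ (f x₀) = 1`. The implicit function theorem for
`ℓ (φ t (x₀ + y) - x₀) = 0` gives a `C^r` crossing time near each transverse crossing
(`IsFlowOn.exists_crossing_time`). A continuous return time must agree with it, so that every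
Poincaré map is `C^r` (`IsPoincareMap.eventually_contDiffAt`). If `T` is the least period, the
crossing time near `T` is the first return time to a small piece of the hyperplane
(`IsFlowOn.exists_isPoincareMap`).

The derivative of the Poincaré map is the compression of the monodromy operator to `V` along `f x₀`
(`IsPoincareMap.fderiv_zero`), and the monodromy operator fixes `f x₀`
(`IsFlowOn.fderiv_period_apply`). Its matrix in a basis of `V` completed by `f x₀` is thus block
triangular, with blocks the derivative of the Poincaré map and `1` (`complexEigenvalues_eq_cons`).
-/

open scoped unitInterval ContDiff

/-! ### Superposition operators on spaces of continuous curves -/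

section Superposition

universe u
variable {K : Type*} [TopologicalSpace K] [CompactSpace K]

open Classical in
/-- The superposition operator `α ↦ f ∘ α` on continuous maps. The value is `0` when `f ∘ α` fails
to be continuous, which allows `f` to be well behaved on an open set only. -/
noncomputable def superposition {E F : Type*} [TopologicalSpace E] [TopologicalSpace F] [Zero F]
    (f : E → F) (α : C(K, E)) : C(K, F) :=
  if h : Continuous (f ∘ α) then ⟨f ∘ α, h⟩ else 0

theorem superposition_apply {K E F : Type*} [TopologicalSpace K] [TopologicalSpace E]
    [TopologicalSpace F] [Zero F] {D : Set E} {f : E → F} (hf : ContinuousOn f D)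
    {α : C(K, E)} (hα : ∀ t, α t ∈ D) (t : K) :
    superposition f α t = f (α t) := by
  have h : Continuous (f ∘ α) := hf.comp_continuous α.continuous hα
  simp [superposition, dif_pos h]

theorem isOpen_setOf_forall_mem {E : Type*} [TopologicalSpace E] {D : Set E} (hD : IsOpen D) :
    IsOpen {α : C(K, E) | ∀ t, α t ∈ D} := by
  have := ContinuousMap.isOpen_setOfPred_mapsTo (X := K) isCompact_univ hD
  simpa [MapsTo] using this

theorem continuousOn_superposition {K E F : Type*} [TopologicalSpace K] [TopologicalSpace E]
    [TopologicalSpace F] [Zero F] {D : Set E} {f : E → F} (hD : IsOpen D) (hf : ContinuousOn f D) :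
    ContinuousOn (superposition f) {α : C(K, E) | ∀ t, α t ∈ D} := by
  intro α hα
  refine ContinuousMap.tendsto_nhds_compactOpen.2 fun C hC U hU hCU => ?_
  have hopen : IsOpen (D ∩ f ⁻¹' U) := hf.isOpen_inter_preimage hD hU
  have hmaps : MapsTo α C (D ∩ f ⁻¹' U) := fun t ht =>
    ⟨hα t, by simpa [superposition_apply hf hα] using hCU ht⟩
  have h1 : ∀ᶠ β : C(K, E) in 𝓝[{α : C(K, E) | ∀ t, α t ∈ D}] α, MapsTo β C (D ∩ f ⁻¹' U) :=
    nhdsWithin_le_nhds ((ContinuousMap.isOpen_setOfPred_mapsTo hC hopen).mem_nhds hmaps)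
  filter_upwards [h1, self_mem_nhdsWithin] with β hβ hβD t ht
  rw [superposition_apply hf hβD]
  exact (hβ ht).2

variable {E F : Type*} [NormedAddCommGroup E] [NormedSpace ℝ E]
  [NormedAddCommGroup F] [NormedSpace ℝ F] {D : Set E} {f : E → F}

/-- Pointwise application of a continuous family of operators to a continuous curve, as a
continuous bilinear map. -/
noncomputable def pointwiseApply (K E F : Type*) [TopologicalSpace K] [CompactSpace K]
    [NormedAddCommGroup E] [NormedSpace ℝ E] [NormedAddCommGroup F] [NormedSpace ℝ F] :
    C(K, E →L[ℝ] F) →L[ℝ] C(K, E) →L[ℝ] C(K, F) :=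
  LinearMap.mkContinuous₂
    (LinearMap.mk₂ ℝ
      (fun (A : C(K, E →L[ℝ] F)) (η : C(K, E)) => (⟨fun t => A t (η t), by fun_prop⟩ : C(K, F)))
      (fun _ _ _ => by ext; simp) (fun _ _ _ => by ext; simp)
      (fun _ _ _ => by ext; simp) (fun _ _ _ => by ext; simp)) 1
    (fun A η => by
      refine (ContinuousMap.norm_le _ (by positivity)).2 fun t => ?_
      simp only [LinearMap.mk₂_apply, ContinuousMap.coe_mk, one_mul]
      exact ((A t).le_opNorm _).trans
        (by gcongr; exacts [A.norm_coe_le_norm t, η.norm_coe_le_norm t]))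

@[simp]
theorem pointwiseApply_apply (A : C(K, E →L[ℝ] F)) (η : C(K, E)) (t : K) :
    pointwiseApply K E F A η t = A t (η t) := rfl

theorem hasFDerivAt_superposition (hD : IsOpen D) (hf : ContDiffOn ℝ 1 f D) {α : C(K, E)}
    (hα : ∀ t, α t ∈ D) :
    HasFDerivAt (superposition f) (pointwiseApply K E F (superposition (fderiv ℝ f) α)) α := by
  have hf' : ContinuousOn (fderiv ℝ f) D := hf.continuousOn_fderiv_of_isOpen hD le_rfl
  have hd : ∀ x ∈ D, HasFDerivAt f (fderiv ℝ f x) x := fun x hx =>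
    ((hf.differentiableOn one_ne_zero).differentiableAt (hD.mem_nhds hx)).hasFDerivAt
  have hopen := isOpen_setOf_forall_mem (K := K) hD
  rw [hasFDerivAt_iff_isLittleO_nhds_zero, Asymptotics.isLittleO_iff]
  intro ε hε
  have h1 : ∀ᶠ β in 𝓝 α, (∀ t, β t ∈ D) ∧
      dist (superposition (fderiv ℝ f) β) (superposition (fderiv ℝ f) α) < ε :=
    (hopen.eventually_mem hα).and
      (((continuousOn_superposition hD hf').continuousAt (hopen.mem_nhds hα)).tendsto.eventually
        (Metric.ball_mem_nhds (superposition (fderiv ℝ f) α) hε))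
  obtain ⟨δ, hδ, hball⟩ := Metric.eventually_nhds_iff_ball.1 h1
  filter_upwards [Metric.ball_mem_nhds (0 : C(K, E)) hδ] with η hη
  rw [mem_ball_zero_iff] at hη
  refine (ContinuousMap.norm_le _ (by positivity)).2 fun t => ?_
  -- translating `α` by a constant curve turns a uniform estimate near `α` into a pointwise one
  have key : ∀ y ∈ Metric.ball (α t) δ, y ∈ D ∧ ‖fderiv ℝ f y - fderiv ℝ f (α t)‖ ≤ ε := by
    intro y hy
    have hβ : α + ContinuousMap.const K (y - α t) ∈ Metric.ball α δ := by
      rw [mem_ball_iff_norm, add_sub_cancel_left]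
      refine (ContinuousMap.norm_lt_iff _ hδ).2 fun _ => ?_
      simpa [dist_eq_norm] using hy
    obtain ⟨hβD, hβd⟩ := hball _ hβ
    have hyt : (α + ContinuousMap.const K (y - α t)) t = y := by simp
    refine ⟨hyt ▸ hβD t, ?_⟩
    have := (ContinuousMap.dist_apply_le_dist (f := superposition (fderiv ℝ f) _) t).trans hβd.le
    rwa [superposition_apply hf' hβD, superposition_apply hf' hα, hyt, dist_eq_norm] at this
  have hηt : ‖η t‖ < δ := (η.norm_coe_le_norm t).trans_lt hη
  have hmv := (convex_ball (α t) δ).norm_image_sub_le_of_norm_hasFDerivWithin_le' (f := f)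
    (f' := fderiv ℝ f) (φ := fderiv ℝ f (α t)) (C := ε) (x := α t) (y := α t + η t)
    (fun y hy => (hd y (key y hy).1).hasFDerivWithinAt) (fun y hy => (key y hy).2)
    (Metric.mem_ball_self hδ) (by simpa [dist_eq_norm] using hηt)
  have hαη : ∀ s, (α + η) s ∈ D := (hball (α + η) (by simpa [dist_eq_norm] using hη)).1
  simp only [ContinuousMap.sub_apply, superposition_apply hf.continuousOn hαη,
    superposition_apply hf.continuousOn hα, pointwiseApply_apply, superposition_apply hf' hα]
  simp only [add_sub_cancel_left, ContinuousMap.add_apply] at hmv ⊢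
  exact hmv.trans (by gcongr; exact η.norm_coe_le_norm t)

/-- A superposition operator is as smooth as the function that defines it: its derivative is again
a superposition operator, followed by a continuous linear map. -/
theorem contDiffOn_superposition {E : Type u} [NormedAddCommGroup E] [NormedSpace ℝ E]
    {D : Set E} (hD : IsOpen D) (k : ℕ) :
    ∀ {F : Type u} [NormedAddCommGroup F] [NormedSpace ℝ F] {f : E → F},
      ContDiffOn ℝ k f D → ContDiffOn ℝ k (superposition f) {α : C(K, E) | ∀ t, α t ∈ D} := by
  induction k with
  | zero =>
    intro F _ _ f hf
    exact contDiffOn_zero.2 (continuousOn_superposition hD hf.continuousOn)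
  | succ k ih =>
    intro F _ _ f hf
    have hf1 : ContDiffOn ℝ 1 f D := hf.of_le (by exact_mod_cast Nat.le_add_left 1 k)
    have hder := fun (α : C(K, E)) (hα : ∀ t, α t ∈ D) => hasFDerivAt_superposition hD hf1 hα
    push_cast at hf ⊢
    rw [contDiffOn_succ_iff_fderiv_of_isOpen (isOpen_setOf_forall_mem hD)]
    refine ⟨fun α hα => (hder α hα).differentiableAt.differentiableWithinAt, by simp, ?_⟩
    have h2 := ih ((contDiffOn_succ_iff_fderiv_of_isOpen hD).1 hf).2.2
    have h3 : ContDiff ℝ k (pointwiseApply K E F) :=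
      ContinuousLinearMap.contDiff (𝕜 := ℝ) (E := C(K, E →L[ℝ] F)) (F := C(K, E) →L[ℝ] C(K, F)) _
    have h4 := h3.comp_contDiffOn h2
    exact h4.congr fun α hα => (hder α hα).fderiv

/-- A continuous multilinear map acts pointwise on continuous curves. -/
noncomputable def pointwiseMultilinear {n : ℕ} (K : Type*) [TopologicalSpace K] [CompactSpace K]
    (p : ContinuousMultilinearMap ℝ (fun _ : Fin n => E) F) :
    ContinuousMultilinearMap ℝ (fun _ : Fin n => C(K, E)) C(K, F) :=
  MultilinearMap.mkContinuous
    { toFun := fun η => ⟨fun t => p fun i => η i t, by fun_prop⟩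
      map_update_add' := fun η i x y => by
        ext t
        simp [funext (Function.apply_update (fun _ (β : C(K, E)) => β t) η i _)]
      map_update_smul' := fun η i c x => by
        ext t
        simp [funext (Function.apply_update (fun _ (β : C(K, E)) => β t) η i _)] } ‖p‖
    (fun η => by
      refine (ContinuousMap.norm_le _ (by positivity)).2 fun t => ?_
      refine (p.le_opNorm _).trans ?_
      gcongr with i
      exact (η i).norm_coe_le_norm t)

theorem norm_pointwiseMultilinear_le {n : ℕ}
    (p : ContinuousMultilinearMap ℝ (fun _ : Fin n => E) F) : ‖pointwiseMultilinear K p‖ ≤ ‖p‖ :=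
  MultilinearMap.mkContinuous_norm_le _ (norm_nonneg _) _

/-- The power series of `f` at `x`, applied pointwise, is a power series at the constant curve `x`
for the superposition operator of `f`. -/
theorem analyticAt_superposition_const [CompleteSpace F] {x : E} (hf : AnalyticAt ℝ f x)
    (hD : D ∈ 𝓝 x) (hfD : ContinuousOn f D) :
    AnalyticAt ℝ (superposition f) (ContinuousMap.const K x) := by
  obtain ⟨p, r, hp⟩ := hf
  obtain ⟨ε, hε, hεD⟩ := Metric.mem_nhds_iff.1 hD
  -- on the ball of radius `q`, the series converges and the curves stay in `D`
  obtain ⟨q, hq0, hq⟩ : ∃ q : ℝ, 0 < q ∧ ENNReal.ofReal q < min r (ENNReal.ofReal ε) := by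
    have : 0 < min r (ENNReal.ofReal ε) := lt_min hp.r_pos (by simpa using hε)
    obtain ⟨q, hq0, hq⟩ := ENNReal.lt_iff_exists_nnreal_btwn.1 this
    exact ⟨q, by exact_mod_cast hq0, by simpa using hq⟩
  have hqr := hq.trans_le (min_le_left _ _)
  have hqε : q < ε := (ENNReal.ofReal_lt_ofReal_iff hε).1 (hq.trans_le (min_le_right _ _))
  let P : FormalMultilinearSeries ℝ C(K, E) C(K, F) := fun n => pointwiseMultilinear K (p n)
  have hsum : Summable fun n => ‖p n‖ * q ^ n := by
    have := p.summable_norm_mul_pow (r := q.toNNReal) (hqr.trans_le hp.r_le)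
    simpa [Real.coe_toNNReal _ hq0.le] using this
  refine ⟨P, ENNReal.ofReal q, ?_, by simpa using hq0, ?_⟩
  · refine P.le_radius_of_summable (hsum.of_nonneg_of_le (fun n => by positivity) fun n => ?_)
    rw [Real.coe_toNNReal _ hq0.le]
    gcongr
    exact norm_pointwiseMultilinear_le _
  · intro η hη
    have hη' : ‖η‖ < q := by
      rw [Metric.eball_ofReal] at hη
      simpa using hη
    have hηt : ∀ t, ‖η t‖ < q := fun t => (η.norm_coe_le_norm t).trans_lt hη'
    have hsummable : Summable fun n => P n fun _ => η := by
      refine Summable.of_norm_bounded hsum fun n => ?_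
      refine ((P n).le_opNorm _).trans ?_
      simp only [Finset.prod_const, Finset.card_univ, Fintype.card_fin]
      gcongr
      exact norm_pointwiseMultilinear_le _
    convert! hsummable.hasSum
    ext t
    have hmem : ∀ s, (ContinuousMap.const K x + η) s ∈ D := fun s =>
      hεD (by simpa [dist_eq_norm] using (hηt s).trans hqε)
    rw [superposition_apply hfD hmem]
    have h1 := hp.hasSum (y := η t) (by
      refine Metric.eball_subset_eball hqr.le ?_
      rw [Metric.eball_ofReal]
      simpa using hηt t)
    have h2 := (ContinuousMap.hasSum_apply hsummable.hasSum t)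
    simpa using h1.unique h2

end Superposition

/-! ### Uniqueness of solutions -/

section Uniqueness

variable {E : Type*} [NormedAddCommGroup E] [NormedSpace ℝ E] {D : Set E} {f : E → E}

theorem exists_lipschitzOnWith_of_isCompact (hD : IsOpen D) (hf : ContDiffOn ℝ 1 f D) {C : Set E}
    (hC : IsCompact C) (hCD : C ⊆ D) : ∃ L, LipschitzOnWith L f C := by
  refine LocallyLipschitzOn.exists_lipschitzOnWith_of_compact hC fun x hx => ?_
  obtain ⟨L, t, ht, hL⟩ := (hf.contDiffAt (hD.mem_nhds (hCD hx))).exists_lipschitzOnWith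
  exact ⟨L, t, mem_nhdsWithin_of_mem_nhds ht, hL⟩

theorem eqOn_Icc_of_hasDerivWithinAt (hD : IsOpen D) (hf : ContDiffOn ℝ 1 f D) {a b : ℝ}
    {α β : ℝ → E} (hα : ContinuousOn α (Icc a b)) (hαD : ∀ t ∈ Icc a b, α t ∈ D)
    (hα' : ∀ t ∈ Ico a b, HasDerivWithinAt α (f (α t)) (Ici t) t)
    (hβ : ContinuousOn β (Icc a b)) (hβD : ∀ t ∈ Icc a b, β t ∈ D)
    (hβ' : ∀ t ∈ Ico a b, HasDerivWithinAt β (f (β t)) (Ici t) t)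
    (h : α a = β a) : EqOn α β (Icc a b) := by
  obtain ⟨L, hL⟩ := exists_lipschitzOnWith_of_isCompact hD hf
    ((isCompact_Icc.image_of_continuousOn hα).union (isCompact_Icc.image_of_continuousOn hβ))
    (union_subset (image_subset_iff.2 hαD) (image_subset_iff.2 hβD))
  exact ODE_solution_unique_of_mem_Icc_right (v := fun _ => f) (fun _ _ => hL) hα hα'
    (fun t ht => Or.inl ⟨t, Ico_subset_Icc_self ht, rfl⟩) hβ hβ'
    (fun t ht => Or.inr ⟨t, Ico_subset_Icc_self ht, rfl⟩) h

theorem IsIntegralCurve.eq_of_mem (hD : IsOpen D) (hf : ContDiffOn ℝ 1 f D) {α β : ℝ → E}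
    (hα : IsIntegralCurve α fun _ => f) (hαD : ∀ t, α t ∈ D)
    (hβ : IsIntegralCurve β fun _ => f) (hβD : ∀ t, β t ∈ D) {t₀ : ℝ} (h : α t₀ = β t₀) :
    α = β := by
  ext t
  let a := min t t₀ - 1
  let b := max t t₀ + 1
  have hαc : ContinuousOn α (Icc a b) := hα.continuous.continuousOn
  have hβc : ContinuousOn β (Icc a b) := hβ.continuous.continuousOn
  obtain ⟨L, hL⟩ := exists_lipschitzOnWith_of_isCompact hD hf
    ((isCompact_Icc.image_of_continuousOn hαc).union (isCompact_Icc.image_of_continuousOn hβc))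
    (union_subset (image_subset_iff.2 fun t _ => hαD t) (image_subset_iff.2 fun t _ => hβD t))
  refine ODE_solution_unique_of_mem_Icc (v := fun _ => f) (t₀ := t₀) (fun _ _ => hL) ?_ hαc
    (fun t _ => hα t) (fun t ht => Or.inl ⟨t, Ioo_subset_Icc_self ht, rfl⟩) hβc
    (fun t _ => hβ t) (fun t ht => Or.inr ⟨t, Ioo_subset_Icc_self ht, rfl⟩) h ?_
  · constructor
    · have := min_le_right t t₀; simp only [a]; linarith
    · have := le_max_right t t₀; simp only [b]; linarith
  · constructor
    · have := min_le_left t t₀; simp only [a]; linarith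
    · have := le_max_left t t₀; simp only [b]; linarith

end Uniqueness

/-! ### Smooth dependence of the flow on time and initial value -/

/-- Indefinite integration from `0` of continuous curves on the unit interval. -/
noncomputable def primitiveCLM (E : Type*) [NormedAddCommGroup E] [NormedSpace ℝ E] :
    C(I, E) →L[ℝ] C(I, E) :=
  LinearMap.mkContinuous
    { toFun := fun α => ⟨fun u => ∫ v in (0 : ℝ)..u, α (projIcc 0 1 zero_le_one v),
        (intervalIntegral.continuous_primitive (fun a b =>
          (α.continuous.comp continuous_projIcc).intervalIntegrable a b) 0).comp
          continuous_subtype_val⟩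
      map_add' := fun α β => by
        ext u
        exact intervalIntegral.integral_add
          ((α.continuous.comp continuous_projIcc).intervalIntegrable _ _)
          ((β.continuous.comp continuous_projIcc).intervalIntegrable _ _)
      map_smul' := fun c α => by
        ext u
        exact intervalIntegral.integral_smul _ _ } 1
    (fun α => by
      refine (ContinuousMap.norm_le _ (by positivity)).2 fun u => ?_
      have h := intervalIntegral.norm_integral_le_of_norm_le_const (a := 0) (b := u)
        (f := fun v => α (projIcc 0 1 zero_le_one v)) (C := ‖α‖)
        fun v _ => α.norm_coe_le_norm _
      refine h.trans ?_
      rw [sub_zero, abs_of_nonneg u.2.1, mul_comm]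
      gcongr
      exact u.2.2)

theorem primitiveCLM_apply {E : Type*} [NormedAddCommGroup E] [NormedSpace ℝ E] (α : C(I, E))
    (u : I) : primitiveCLM E α u = ∫ v in (0 : ℝ)..u, α (projIcc 0 1 zero_le_one v) := rfl

/-- The map whose zeros are the pairs of `(s, x)` and a solution of `α' = s • f α`, `α 0 = x`, on
the unit interval, in integrated form. -/
noncomputable def integralEquation {E : Type*} [NormedAddCommGroup E] [NormedSpace ℝ E]
    (f : E → E) (p : (ℝ × E) × C(I, E)) : C(I, E) :=
  p.2 - ContinuousLinearMap.const ℝ I p.1.2 - p.1.1 • primitiveCLM E (superposition f p.2)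

section Flow

variable {n : ℕ} {f : EuclideanSpace ℝ (Fin n) → EuclideanSpace ℝ (Fin n)}
  {D : Set (EuclideanSpace ℝ (Fin n))}
  {φ : ℝ → EuclideanSpace ℝ (Fin n) → EuclideanSpace ℝ (Fin n)}

theorem IsFlowOn.add (hD : IsOpen D) (hf : ContDiffOn ℝ 1 f D) (hφ : IsFlowOn f D φ)
    {x : EuclideanSpace ℝ (Fin n)} (hx : x ∈ D) (s t : ℝ) : φ (s + t) x = φ s (φ t x) := by
  have h := IsIntegralCurve.eq_of_mem hD hf (t₀ := 0)
    ((hφ.isIntegralCurve x hx).comp_add t) (fun s => hφ.mem x hx _)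
    (hφ.isIntegralCurve _ (hφ.mem x hx t)) (fun s => hφ.mem _ (hφ.mem x hx t) s)
    (by simp [hφ.zero _ (hφ.mem x hx t)])
  exact congrFun h s

/-- A zero of the integral equation that takes its values in `D` is a piece of an orbit. -/
theorem IsFlowOn.eq_apply_of_integralEquation_eq_zero (hD : IsOpen D) (hf : ContDiffOn ℝ 1 f D)
    (hφ : IsFlowOn f D φ) {x : EuclideanSpace ℝ (Fin n)} (hx : x ∈ D) {s : ℝ}
    {α : C(I, EuclideanSpace ℝ (Fin n))} (hα : ∀ u, α u ∈ D)
    (h : integralEquation f ((s, x), α) = 0) : α 1 = φ s x := by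
  have hN : ∀ u, superposition f α u = f (α u) := superposition_apply hf.continuousOn hα
  let g : ℝ → EuclideanSpace ℝ (Fin n) := fun v => superposition f α (projIcc 0 1 zero_le_one v)
  have hg : Continuous g := (superposition f α).continuous.comp continuous_projIcc
  let β : ℝ → EuclideanSpace ℝ (Fin n) := fun u => x + s • ∫ v in (0 : ℝ)..u, g v
  have hβ' : ∀ u, HasDerivAt β (s • g u) u := fun u =>
    ((intervalIntegral.integral_hasDerivAt_right (hg.intervalIntegrable _ _)
      (hg.stronglyMeasurableAtFilter _ _) hg.continuousAt).const_smul s).const_add x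
  have hβα : ∀ u : I, β u = α u := by
    intro u
    have := congrArg (fun γ : C(I, EuclideanSpace ℝ (Fin n)) => γ u) h
    simp only [integralEquation, ContinuousMap.sub_apply, ContinuousMap.smul_apply,
      primitiveCLM_apply, ContinuousMap.zero_apply, ContinuousLinearMap.const_apply_apply] at this
    rw [sub_sub, sub_eq_zero] at this
    exact this.symm
  have hsf : ContDiffOn ℝ 1 (fun y => s • f y) D := hf.const_smul s
  have hφ' : ∀ u, HasDerivAt (fun u => φ (u * s) x) (s • f (φ (u * s) x)) u := fun u => by
    exact (hφ.isIntegralCurve x hx).comp_mul s u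
  have huniq := eqOn_Icc_of_hasDerivWithinAt (a := 0) (b := 1) hD hsf (α := β)
    (fun u _ => (hβ' u).continuousAt.continuousWithinAt)
    (fun u hu => by rw [hβα ⟨u, hu⟩]; exact hα _)
    (fun u hu => by
      have hu' : u ∈ Icc (0 : ℝ) 1 := Ico_subset_Icc_self hu
      convert (hβ' u).hasDerivWithinAt using 2
      simp only [g, hN, projIcc_of_mem _ hu', hβα ⟨u, hu'⟩])
    (fun u _ => (hφ' u).continuousAt.continuousWithinAt) (fun u _ => hφ.mem x hx _)
    (fun u _ => (hφ' u).hasDerivWithinAt) (by simp [β, hφ.zero x hx])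
  have := huniq (right_mem_Icc.2 zero_le_one)
  rw [← hβα 1]
  simpa using this

/-- Smoothness of the flow near time `0` comes from the implicit function theorem in the space of
continuous curves, applied to the integral equation on the unit interval: time is rescaled, so at
`s = 0` the derivative in the curve variable is the identity. -/
theorem IsFlowOn.contDiffAt_zero (hD : IsOpen D) (hf : ContDiffOn ℝ 1 f D) (hφ : IsFlowOn f D φ)
    {x : EuclideanSpace ℝ (Fin n)} (hx : x ∈ D) {k : WithTop ℕ∞} (hk : k ≠ 0)
    (hN : ContDiffAt ℝ k (superposition f) (ContinuousMap.const I x)) :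
    ContDiffAt ℝ k (fun p : ℝ × EuclideanSpace ℝ (Fin n) => φ p.1 p.2) (0, x) := by
  let u : (ℝ × EuclideanSpace ℝ (Fin n)) × C(I, EuclideanSpace ℝ (Fin n)) :=
    ((0, x), ContinuousMap.const I x)
  have hG : ContDiffAt ℝ k (integralEquation f) u := by
    unfold integralEquation
    have h1 : ContDiffAt ℝ k (fun p : (ℝ × EuclideanSpace ℝ (Fin n)) ×
        C(I, EuclideanSpace ℝ (Fin n)) => superposition f p.2) u := hN.comp u contDiffAt_snd
    fun_prop
  have hGu : integralEquation f u = 0 := by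
    ext t; simp [integralEquation, u]
  have hinr : fderiv ℝ (integralEquation f) u ∘L .inr ℝ _ _ = .id ℝ _ := by
    have h1 := (hG.differentiableAt hk).hasFDerivAt
    have h2 : HasFDerivAt (fun α : C(I, EuclideanSpace ℝ (Fin n)) =>
        integralEquation f ((0, x), α)) _ (ContinuousMap.const I x) :=
      h1.comp (ContinuousMap.const I x) (hasFDerivAt_prodMk_right (0, x) _)
    refine h2.unique ?_
    simpa [integralEquation] using! (hasFDerivAt_id (ContinuousMap.const I x)).sub_const
      (ContinuousLinearMap.const ℝ I x)
  have hinv : (fderiv ℝ (integralEquation f) u ∘L .inr ℝ _ _).IsInvertible := by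
    rw [hinr]; exact ⟨.refl ℝ _, rfl⟩
  let ψ := hG.implicitFunction hk hinv
  have hψ : ContDiffAt ℝ k ψ (0, x) := hG.contDiffAt_implicitFunction hk hinv
  have hψ0 : ψ (0, x) = ContinuousMap.const I x := hG.implicitFunction_apply_self hk hinv
  have hψD : ∀ᶠ p in 𝓝 ((0 : ℝ), x), ∀ t, ψ p t ∈ D :=
    hψ.continuousAt.eventually_mem ((isOpen_setOf_forall_mem hD).mem_nhds (by simp [hψ0, hx]))
  have hpD : ∀ᶠ p : ℝ × EuclideanSpace ℝ (Fin n) in 𝓝 ((0 : ℝ), x), p.2 ∈ D :=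
    continuousAt_snd.eventually_mem (hD.mem_nhds hx)
  have heq : (fun p : ℝ × EuclideanSpace ℝ (Fin n) => φ p.1 p.2) =ᶠ[𝓝 (0, x)]
      fun p => ContinuousMap.evalCLM ℝ (1 : I) (ψ p) := by
    filter_upwards [hψD, hpD, hG.eventually_apply_implicitFunction hk hinv] with p h1 h2 h3
    exact (hφ.eq_apply_of_integralEquation_eq_zero hD hf h2 h1 (h3.trans hGu)).symm
  have heval : ContDiff ℝ k fun α : C(I, EuclideanSpace ℝ (Fin n)) =>
      ContinuousMap.evalCLM ℝ (1 : I) α :=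
    ContinuousLinearMap.contDiff (E := C(I, EuclideanSpace ℝ (Fin n)))
      (ContinuousMap.evalCLM ℝ (1 : I))
  exact (heval.contDiffAt.comp _ hψ).congr_of_eventuallyEq heq

theorem contDiffAt_superposition_const (hD : IsOpen D) {k : WithTop ℕ∞} (hk : k ≠ ∞)
    (hf : ContDiffOn ℝ k f D) {x : EuclideanSpace ℝ (Fin n)} (hx : x ∈ D) :
    ContDiffAt ℝ k (superposition f) (ContinuousMap.const I x) := by
  match k, hk with
  | ω, _ =>
    exact (analyticAt_superposition_const (hf.contDiffAt (hD.mem_nhds hx)).analyticAt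
      (hD.mem_nhds hx) hf.continuousOn).contDiffAt
  | (k : ℕ), _ =>
    exact (contDiffOn_superposition hD k hf).contDiffAt
      ((isOpen_setOf_forall_mem hD).mem_nhds fun _ => hx)

/-- The flow is as smooth as the vector field. The times at which it is smooth form an open set,
which is closed as well, by the group property and smoothness near time `0`. -/
theorem IsFlowOn.contDiffAt_of_ne_infty (hD : IsOpen D) {k : WithTop ℕ∞} (hk : k ≠ ∞)
    (hk1 : 1 ≤ k) (hf : ContDiffOn ℝ k f D) (hφ : IsFlowOn f D φ)
    {x : EuclideanSpace ℝ (Fin n)} (hx : x ∈ D) (t : ℝ) :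
    ContDiffAt ℝ k (fun p : ℝ × EuclideanSpace ℝ (Fin n) => φ p.1 p.2) (t, x) := by
  have hk0 : k ≠ 0 := (zero_lt_one.trans_le hk1).ne'
  have hf1 : ContDiffOn ℝ 1 f D := hf.of_le hk1
  have hzero : ∀ y ∈ D,
      ContDiffAt ℝ k (fun p : ℝ × EuclideanSpace ℝ (Fin n) => φ p.1 p.2) (0, y) := fun y hy =>
    hφ.contDiffAt_zero hD hf1 hy hk0 (contDiffAt_superposition_const hD hk hf hy)
  let S : Set ℝ := {t | ContDiffAt ℝ k (fun p : ℝ × EuclideanSpace ℝ (Fin n) => φ p.1 p.2) (t, x)}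
  have hSopen : IsOpen S := isOpen_iff_mem_nhds.2 fun t ht =>
    (Continuous.prodMk_left x).continuousAt.eventually (ContDiffAt.eventually ht hk)
  have hSclosed : IsClosed S := by
    refine isClosed_iff_frequently.2 fun t ht => ?_
    have h1 := (hzero _ (hφ.mem x hx t)).eventually hk
    have hcont : ContinuousAt (fun t₁ => (t - t₁, φ t₁ x)) t :=
      (continuous_const.sub continuous_id).continuousAt.prodMk
        (hφ.isIntegralCurve x hx t).continuousAt
    have h2 : ∀ᶠ t₁ in 𝓝 t, ContDiffAt ℝ k
        (fun p : ℝ × EuclideanSpace ℝ (Fin n) => φ p.1 p.2) (t - t₁, φ t₁ x) :=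
      hcont.eventually (by simpa using h1)
    -- a smooth time `t₁` so close to `t` that the flow is smooth at time `t - t₁` near `φ t₁ x`
    obtain ⟨t₁, ht₁, h3⟩ := (ht.and_eventually h2).exists
    have h4 : ContDiffAt ℝ k (fun y => φ t₁ y) x :=
      ContDiffAt.comp x (f := fun y => (t₁, y)) ht₁ (by fun_prop)
    have h5 : ContDiffAt ℝ k (fun p : ℝ × EuclideanSpace ℝ (Fin n) => (p.1 - t₁, φ t₁ p.2))
        (t, x) := (contDiffAt_fst.sub contDiffAt_const).prodMk
          (ContDiffAt.comp (t, x) (f := Prod.snd) (g := fun y => φ t₁ y) h4 contDiffAt_snd)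
    refine (ContDiffAt.comp (t, x) (f := fun p : ℝ × EuclideanSpace ℝ (Fin n) =>
      (p.1 - t₁, φ t₁ p.2)) h3 h5).congr_of_eventuallyEq ?_
    have hpD : ∀ᶠ p : ℝ × EuclideanSpace ℝ (Fin n) in 𝓝 (t, x), p.2 ∈ D :=
      continuousAt_snd.eventually_mem (hD.mem_nhds hx)
    filter_upwards [hpD] with p hp
    simp only [Function.comp_apply]
    rw [← hφ.add hD hf1 hp, sub_add_cancel]
  have hS : S = univ := IsClopen.eq_univ ⟨hSclosed, hSopen⟩ ⟨0, hzero x hx⟩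
  exact (hS.symm ▸ mem_univ t : t ∈ S)

theorem IsFlowOn.contDiffAt (hD : IsOpen D) {r : WithTop ℕ∞} (hr : 1 ≤ r)
    (hf : ContDiffOn ℝ r f D) (hφ : IsFlowOn f D φ) {x : EuclideanSpace ℝ (Fin n)} (hx : x ∈ D)
    (t : ℝ) : ContDiffAt ℝ r (fun p : ℝ × EuclideanSpace ℝ (Fin n) => φ p.1 p.2) (t, x) := by
  by_cases h : r = ∞
  · subst h
    refine contDiffAt_infty.2 fun k => ?_
    refine (hφ.contDiffAt_of_ne_infty hD (k := (k + 1 : ℕ)) (by simp)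
      (by exact_mod_cast Nat.le_add_left 1 k) (hf.of_le ?_) hx t).of_le ?_
    · exact_mod_cast le_top
    · exact_mod_cast Nat.le_succ k
  · exact hφ.contDiffAt_of_ne_infty hD h hr hf hx t

end Flow

/-! ### The linearized equation -/

section Linearized

variable {n : ℕ} {f : EuclideanSpace ℝ (Fin n) → EuclideanSpace ℝ (Fin n)}
  {D : Set (EuclideanSpace ℝ (Fin n))}
  {φ : ℝ → EuclideanSpace ℝ (Fin n) → EuclideanSpace ℝ (Fin n)}

theorem IsPrincipalSolution.eq_of_nonneg
    {A U W : ℝ → EuclideanSpace ℝ (Fin n) →L[ℝ] EuclideanSpace ℝ (Fin n)} (hA : Continuous A)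
    (hU : IsPrincipalSolution A U) (hW : IsPrincipalSolution A W) {t : ℝ} (ht : 0 ≤ t) :
    U t = W t := by
  obtain ⟨C, hC⟩ := (isCompact_Icc (a := (0 : ℝ)) (b := t)).exists_bound_of_continuousOn
    hA.continuousOn
  refine ODE_solution_unique_of_mem_Icc_right (a := 0) (b := t) (s := fun _ => univ)
    (v := fun s B => A s ∘L B) (K := C.toNNReal) (fun s hs => ?_)
    (fun s _ => (hU.hasDerivAt s).continuousAt.continuousWithinAt)
    (fun s _ => (hU.hasDerivAt s).hasDerivWithinAt) (fun _ _ => mem_univ _)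
    (fun s _ => (hW.hasDerivAt s).continuousAt.continuousWithinAt)
    (fun s _ => (hW.hasDerivAt s).hasDerivWithinAt) (fun _ _ => mem_univ _)
    (hU.zero.trans hW.zero.symm) (right_mem_Icc.2 ht)
  refine (LipschitzWith.of_dist_le_mul fun B B' => ?_).lipschitzOnWith
  rw [dist_eq_norm, dist_eq_norm, ← ContinuousLinearMap.comp_sub]
  refine (ContinuousLinearMap.opNorm_comp_le _ _).trans ?_
  gcongr
  exact (hC s (Ico_subset_Icc_self hs)).trans (Real.le_coe_toNNReal C)

/-- The derivative of the flow with respect to the initial value solves the linearized equation: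
differentiate `φ t y = y + ∫ s in 0..t, f (φ s y)` under the integral sign. -/
theorem IsFlowOn.isPrincipalSolution_fderiv (hD : IsOpen D) (hf : ContDiffOn ℝ 1 f D)
    (hφ : IsFlowOn f D φ) {x : EuclideanSpace ℝ (Fin n)} (hx : x ∈ D) :
    IsPrincipalSolution (fun t => fderiv ℝ f (φ t x)) fun t => fderiv ℝ (φ t) x := by
  let Φ : ℝ × EuclideanSpace ℝ (Fin n) → EuclideanSpace ℝ (Fin n) := fun p => φ p.1 p.2
  have hΦ : ∀ t, ∀ y ∈ D, ContDiffAt ℝ 1 Φ (t, y) := fun t y hy =>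
    hφ.contDiffAt hD le_rfl hf hy t
  have hΦD : ContDiffOn ℝ 1 Φ (univ ×ˢ D) := fun p hp => (hΦ p.1 p.2 hp.2).contDiffWithinAt
  have hopen : IsOpen ((univ : Set ℝ) ×ˢ D) := isOpen_univ.prod hD
  have hφd : ∀ t, ∀ y ∈ D, HasFDerivAt (φ t) (fderiv ℝ Φ (t, y) ∘L .inr ℝ _ _) y :=
    fun t y hy => ((hΦ t y hy).differentiableAt one_ne_zero).hasFDerivAt.comp y
      (hasFDerivAt_prodMk_right t y)
  have hfd : ∀ y ∈ D, HasFDerivAt f (fderiv ℝ f y) y := fun y hy =>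
    ((hf.differentiableOn one_ne_zero).differentiableAt (hD.mem_nhds hy)).hasFDerivAt
  -- the spatial derivative of `f (φ s y)`
  let H : ℝ × EuclideanSpace ℝ (Fin n) → EuclideanSpace ℝ (Fin n) →L[ℝ] EuclideanSpace ℝ (Fin n) :=
    fun p => fderiv ℝ f (Φ p) ∘L (fderiv ℝ Φ p ∘L .inr ℝ _ _)
  have hH : ContinuousOn H (univ ×ˢ D) := by
    have h1 : ContinuousOn (fun p => fderiv ℝ f (Φ p)) (univ ×ˢ D) :=
      (hf.continuousOn_fderiv_of_isOpen hD le_rfl).comp hΦD.continuousOn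
        fun p hp => hφ.mem _ hp.2 _
    have h2 := hΦD.continuousOn_fderiv_of_isOpen hopen le_rfl
    exact h1.clm_comp (h2.clm_comp continuousOn_const)
  have hHx : ∀ y ∈ D, Continuous fun s => H (s, y) := fun y hy =>
    hH.comp_continuous (Continuous.prodMk_left y) fun s => ⟨mem_univ _, hy⟩
  have hfφ : ∀ y ∈ D, Continuous fun s => f (φ s y) := fun y hy =>
    hf.continuousOn.comp_continuous (hφ.isIntegralCurve y hy).continuous fun s => hφ.mem y hy s
  have hint : ∀ t, ∀ y ∈ D, φ t y = y + ∫ s in (0 : ℝ)..t, f (φ s y) := fun t y hy => by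
    rw [intervalIntegral.integral_eq_sub_of_hasDerivAt
      (fun s _ => hφ.isIntegralCurve y hy s) ((hfφ y hy).intervalIntegrable _ _), hφ.zero y hy]
    abel
  have hfderiv : ∀ t, fderiv ℝ (φ t) x = .id ℝ _ + ∫ s in (0 : ℝ)..t, H (s, x) := by
    intro t
    obtain ⟨ε, hε, hεD⟩ := Metric.nhds_basis_closedBall.mem_iff.1 (hD.mem_nhds hx)
    obtain ⟨C, hC⟩ := ((isCompact_uIcc (a := (0 : ℝ)) (b := t)).prod
      (isCompact_closedBall x ε)).exists_bound_of_continuousOn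
      (hH.mono (prod_mono (subset_univ _) hεD))
    have h1 : HasFDerivAt (fun y => ∫ s in (0 : ℝ)..t, f (φ s y)) (∫ s in (0 : ℝ)..t, H (s, x)) x :=
      intervalIntegral.hasFDerivAt_integral_of_dominated_of_fderiv_le
        (F := fun y s => f (φ s y)) (F' := fun y s => H (s, y)) (bound := fun _ => C)
        (Metric.closedBall_mem_nhds x hε)
        (by
          filter_upwards [hD.mem_nhds hx] with y hy
          exact (hfφ y hy).aestronglyMeasurable)
        ((hfφ x hx).intervalIntegrable _ _) (hHx x hx).aestronglyMeasurable
        (Eventually.of_forall fun s hs y hy => hC (s, y) ⟨uIoc_subset_uIcc hs, hy⟩)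
        intervalIntegrable_const
        (Eventually.of_forall fun s _ y hy =>
          (hfd _ (hφ.mem y (hεD hy) s)).comp y (hφd s y (hεD hy)))
    refine HasFDerivAt.fderiv ?_
    refine ((hasFDerivAt_id x).add h1).congr_of_eventuallyEq ?_
    filter_upwards [hD.mem_nhds hx] with y hy
    exact hint t y hy
  refine ⟨by simp [hfderiv], fun t => ?_⟩
  rw [(hφd t x hx).fderiv, funext hfderiv]
  exact (intervalIntegral.integral_hasDerivAt_right ((hHx x hx).intervalIntegrable _ _)
    ((hHx x hx).stronglyMeasurableAtFilter _ _) (hHx x hx).continuousAt).const_add _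

end Linearized

/-! ### Eigenvalues of an endomorphism with a fixed vector transverse to a hyperplane -/

section Eigenvalues

/-- If `L` fixes `e` and `π` is a projection onto `V` with kernel spanned by `e`, then in a basis of
`V` completed by `e` the matrix of `L` is block triangular, with diagonal blocks the compression of
`L` to `V` and `1`. -/
theorem LinearMap.charpoly_eq_of_apply_eq_self {E : Type*} [AddCommGroup E] [Module ℝ E]
    [FiniteDimensional ℝ E] {V : Submodule ℝ E} (ℓ : E →ₗ[ℝ] ℝ) (hℓ : ∀ v ∈ V, ℓ v = 0)
    (π : E →ₗ[ℝ] V) {e : E} (he : ℓ e = 1) (hπ : ∀ v, (π v : E) = v - ℓ v • e)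
    (L : E →ₗ[ℝ] E) (hL : L e = e) :
    L.charpoly = (π ∘ₗ L ∘ₗ V.subtype).charpoly * (Polynomial.X - Polynomial.C 1) := by
  let Q : E ≃ₗ[ℝ] V × ℝ := LinearEquiv.ofLinearMap (π.prod ℓ)
    (V.subtype.coprod (LinearMap.toSpanSingleton ℝ E e))
    (by
      ext v
      · simp [hπ, hℓ]
      · simp [hℓ]
      · simp [hπ, he]
      · simp [he])
    (by ext v; simp [hπ])
  rw [← Q.charpoly_conj L]
  let b := Module.finBasis ℝ V
  let b' := b.prod (Module.Basis.singleton Unit ℝ)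
  rw [← LinearMap.charpoly_toMatrix _ b', ← LinearMap.charpoly_toMatrix (π ∘ₗ L ∘ₗ V.subtype) b]
  have hπe : π e = 0 := by ext; simp [hπ, he]
  have hblock : LinearMap.toMatrix b' b' (Q.conj L) = Matrix.fromBlocks
      (LinearMap.toMatrix b b (π ∘ₗ L ∘ₗ V.subtype)) 0
      (Matrix.of fun _ j => ℓ (L (b j))) (1 : Matrix Unit Unit ℝ) := by
    ext (i | i) (j | j) <;>
      simp [b', Q, LinearMap.toMatrix_apply, LinearEquiv.conj_apply, hL, hπe, he]
  rw [hblock, Matrix.charpoly_fromBlocks_zero₁₂]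
  simp [Matrix.charpoly_one]

theorem complexEigenvalues_eq_cons {E : Type*} [AddCommGroup E] [Module ℝ E]
    [FiniteDimensional ℝ E] {V : Submodule ℝ E} (ℓ : E →ₗ[ℝ] ℝ) (hℓ : ∀ v ∈ V, ℓ v = 0)
    (π : E →ₗ[ℝ] V) {e : E} (he : ℓ e = 1) (hπ : ∀ v, (π v : E) = v - ℓ v • e)
    (L : E →ₗ[ℝ] E) (hL : L e = e) :
    complexEigenvalues L = 1 ::ₘ complexEigenvalues (π ∘ₗ L ∘ₗ V.subtype) := by
  have hne := ((LinearMap.charpoly_monic (π ∘ₗ L ∘ₗ V.subtype)).map (algebraMap ℝ ℂ)).ne_zero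
  rw [complexEigenvalues, LinearMap.charpoly_eq_of_apply_eq_self ℓ hℓ π he hπ L hL,
    Polynomial.map_mul, Polynomial.roots_mul]
  · rw [Polynomial.map_sub, Polynomial.map_X, Polynomial.map_C, map_one, Polynomial.roots_X_sub_C,
      add_comm, Multiset.singleton_add, complexEigenvalues]
  · refine mul_ne_zero hne ?_
    simpa using Polynomial.X_sub_C_ne_zero (1 : ℂ)

end Eigenvalues

/-! ### Return to a transverse hyperplane -/

/-- The hyperplane is the zero set of a functional that takes the value `1` on the velocity. -/
theorem IsTransverseHyperplane.exists_dual {n : ℕ} {γ : ℝ → EuclideanSpace ℝ (Fin n)}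
    {V : Submodule ℝ (EuclideanSpace ℝ (Fin n))} (hV : IsTransverseHyperplane γ V) :
    ∃ ℓ : EuclideanSpace ℝ (Fin n) →L[ℝ] ℝ, (∀ v, ℓ v = 0 ↔ v ∈ V) ∧ ℓ (deriv γ 0) = 1 := by
  obtain ⟨g, hg, hVg⟩ := Submodule.exists_le_ker_of_notMem hV.transverse
  have hker : V = LinearMap.ker g := by
    refine Submodule.eq_of_le_of_finrank_le hVg ?_
    have h1 := Submodule.finrank_lt (s := LinearMap.ker g) fun h => hg (by
      have : deriv γ 0 ∈ LinearMap.ker g := h ▸ Submodule.mem_top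
      simpa using this)
    rw [finrank_euclideanSpace_fin] at h1
    have := hV.finrank_add_one
    omega
  refine ⟨(g (deriv γ 0))⁻¹ • LinearMap.toContinuousLinearMap g, fun v => ?_, ?_⟩
  · rw [hker]
    simp [hg]
  · simp [hg]

section Return

variable {n : ℕ} {f : EuclideanSpace ℝ (Fin n) → EuclideanSpace ℝ (Fin n)}
  {D : Set (EuclideanSpace ℝ (Fin n))}
  {φ : ℝ → EuclideanSpace ℝ (Fin n) → EuclideanSpace ℝ (Fin n)}
  {V : Submodule ℝ (EuclideanSpace ℝ (Fin n))} {x₀ : EuclideanSpace ℝ (Fin n)}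
  {ℓ : EuclideanSpace ℝ (Fin n) →L[ℝ] ℝ} {r : WithTop ℕ∞}

/-- The projection onto the kernel `V` of `ℓ` along a vector `e` with `ℓ e = 1`. -/
noncomputable def projAlong (ℓ : EuclideanSpace ℝ (Fin n) →L[ℝ] ℝ) (hℓ : ∀ v, ℓ v = 0 ↔ v ∈ V)
    {e : EuclideanSpace ℝ (Fin n)} (he : ℓ e = 1) : EuclideanSpace ℝ (Fin n) →L[ℝ] V :=
  (.id ℝ _ - ℓ.smulRight e : EuclideanSpace ℝ (Fin n) →L[ℝ] EuclideanSpace ℝ (Fin n)).codRestrict V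
    fun v => (hℓ _).1 (by simp [he])

theorem coe_projAlong (hℓ : ∀ v, ℓ v = 0 ↔ v ∈ V) {e : EuclideanSpace ℝ (Fin n)} (he : ℓ e = 1)
    (v : EuclideanSpace ℝ (Fin n)) : (projAlong ℓ hℓ he v : EuclideanSpace ℝ (Fin n)) =
      v - ℓ v • e := rfl

/-- The value of `ℓ`, relative to `x₀`, at the point reached from `x₀ + y` in time `t`; for `ℓ` with
kernel `V`, it vanishes exactly when the orbit is on the hyperplane `x₀ + V`. -/
noncomputable def sectionHeight (ℓ : EuclideanSpace ℝ (Fin n) →L[ℝ] ℝ)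
    (φ : ℝ → EuclideanSpace ℝ (Fin n) → EuclideanSpace ℝ (Fin n)) (x₀ : EuclideanSpace ℝ (Fin n))
    (V : Submodule ℝ (EuclideanSpace ℝ (Fin n))) (p : V × ℝ) : ℝ :=
  ℓ (φ p.2 (x₀ + p.1) - x₀)

theorem IsFlowOn.contDiffAt_add (hD : IsOpen D) (hr : 1 ≤ r) (hf : ContDiffOn ℝ r f D)
    (hφ : IsFlowOn f D φ) {y : V} (hy : x₀ + (y : EuclideanSpace ℝ (Fin n)) ∈ D) (t : ℝ) :
    ContDiffAt ℝ r (fun p : V × ℝ => φ p.2 (x₀ + p.1)) (y, t) := by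
  have hV : ContDiff ℝ r fun y : V => (y : EuclideanSpace ℝ (Fin n)) := V.subtypeL.contDiff
  exact ContDiffAt.comp (y, t) (g := fun p : ℝ × EuclideanSpace ℝ (Fin n) => φ p.1 p.2)
    (f := fun p : V × ℝ => (p.2, x₀ + (p.1 : EuclideanSpace ℝ (Fin n))))
    (hφ.contDiffAt hD hr hf hy t)
    (contDiffAt_snd.prodMk (contDiffAt_const.add (hV.contDiffAt.comp _ contDiffAt_fst)))

theorem IsFlowOn.hasDerivAt_sectionHeight (hφ : IsFlowOn f D φ) {y : V}
    (hy : x₀ + (y : EuclideanSpace ℝ (Fin n)) ∈ D) (t : ℝ) :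
    HasDerivAt (fun t => sectionHeight ℓ φ x₀ V (y, t)) (ℓ (f (φ t (x₀ + y)))) t :=
  ℓ.hasFDerivAt.comp_hasDerivAt t ((hφ.isIntegralCurve _ hy t).sub_const x₀)

/-- Near a transverse crossing, the times at which orbits meet the hyperplane form the graph of a
function as smooth as the vector field. -/
theorem IsFlowOn.exists_crossing_time (hD : IsOpen D) (hr : 1 ≤ r) (hf : ContDiffOn ℝ r f D)
    (hφ : IsFlowOn f D φ) {y : V} (hy : x₀ + (y : EuclideanSpace ℝ (Fin n)) ∈ D) {t : ℝ}
    (h0 : sectionHeight ℓ φ x₀ V (y, t) = 0) (hne : ℓ (f (φ t (x₀ + y))) ≠ 0) :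
    ∃ θ : V → ℝ, ContDiffAt ℝ r θ y ∧ θ y = t ∧
      ∀ᶠ p in 𝓝 (y, t), sectionHeight ℓ φ x₀ V p = 0 ↔ θ p.1 = p.2 := by
  have hr0 : r ≠ 0 := (zero_lt_one.trans_le hr).ne'
  have hg : ContDiffAt ℝ r (sectionHeight ℓ φ x₀ V) (y, t) :=
    ℓ.contDiff.contDiffAt.comp (y, t) ((hφ.contDiffAt_add hD hr hf hy t).sub contDiffAt_const)
  have hinv : (fderiv ℝ (sectionHeight ℓ φ x₀ V) (y, t) ∘L .inr ℝ V ℝ).IsInvertible := by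
    refine ⟨ContinuousLinearEquiv.unitsEquivAut ℝ (Units.mk0 _ hne), ?_⟩
    ext
    have h1 : HasFDerivAt (fun s => sectionHeight ℓ φ x₀ V (y, s)) _ t :=
      (hg.differentiableAt hr0).hasFDerivAt.comp t (hasFDerivAt_prodMk_right y t)
    have h2 := h1.hasDerivAt.unique (hφ.hasDerivAt_sectionHeight hy t)
    simpa using h2.symm
  refine ⟨hg.implicitFunction hr0 hinv, hg.contDiffAt_implicitFunction hr0 hinv,
    hg.implicitFunction_apply_self hr0 hinv, ?_⟩
  simpa [h0] using hg.eventually_apply_eq_iff_implicitFunction hr0 hinv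

theorem eventually_add_mem (hD : IsOpen D) (hx₀ : x₀ ∈ D) :
    ∀ᶠ y : V in 𝓝 0, x₀ + (y : EuclideanSpace ℝ (Fin n)) ∈ D := by
  have h : ContinuousAt (fun y : V => x₀ + (y : EuclideanSpace ℝ (Fin n))) 0 := by fun_prop
  exact h.eventually_mem (hD.mem_nhds (by simpa))

/-- The return time and the Poincaré map are smooth at every point near `0`. -/
theorem IsPoincareMap.eventually_contDiffAt (hD : IsOpen D) (hr : 1 ≤ r) (hf : ContDiffOn ℝ r f D)
    (hφ : IsFlowOn f D φ) (hx₀ : x₀ ∈ D) {T : ℝ} (hT : φ T x₀ = x₀)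
    (hℓ : ∀ v, ℓ v = 0 ↔ v ∈ V) (hℓf : ℓ (f x₀) = 1) {τ : V → ℝ} {P : V → V}
    (hP : IsPoincareMap φ D x₀ T V τ P) :
    (∀ᶠ y in 𝓝 (0 : V), ContDiffAt ℝ r τ y ∧ ContDiffAt ℝ r P y) ∧
      P =ᶠ[𝓝 0] fun y => projAlong ℓ hℓ hℓf (φ (τ y) (x₀ + y) - x₀) := by
  obtain ⟨N, hN, W, hW, hτ, hτ0, hret⟩ := hP
  have hPeq : ∀ y ∈ N, P y = projAlong ℓ hℓ hℓf (φ (τ y) (x₀ + y) - x₀) := by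
    intro y hy
    have h := (hret y hy).2.2
    ext1
    rw [coe_projAlong, ← h, add_sub_cancel_left, (hℓ _).2 (P y).2]
    simp
  have hτN : ∀ᶠ y in 𝓝 (0 : V), N ∈ 𝓝 y := eventually_mem_nhds_iff.2 hN
  have hτc : ContinuousAt τ 0 := hτ.continuousAt hN
  have hfc : ContinuousAt (fun y : V => ℓ (f (φ (τ y) (x₀ + y)))) 0 := by
    have h1 : ContinuousAt (fun p : V × ℝ => φ p.2 (x₀ + p.1)) (0, τ 0) :=
      (hφ.contDiffAt_add hD hr hf (by simpa) _).continuousAt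
    have h2 : ContinuousAt (fun y : V => φ (τ y) (x₀ + y)) 0 :=
      ContinuousAt.comp (f := fun y : V => (y, τ y)) h1 (continuousAt_id.prodMk hτc)
    have h3 : ContinuousAt f (φ (τ 0) (x₀ + ((0 : V) : EuclideanSpace ℝ (Fin n)))) :=
      hf.continuousOn.continuousAt (hD.mem_nhds (hφ.mem _ (by simpa) _))
    exact ℓ.continuous.continuousAt.comp (ContinuousAt.comp (f := fun y : V => φ (τ y) (x₀ + y))
      h3 h2)
  have hne : ∀ᶠ y in 𝓝 (0 : V), ℓ (f (φ (τ y) (x₀ + y))) ≠ 0 :=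
    hfc.eventually_ne (by simp [hτ0, hT, hℓf])
  refine ⟨?_, by filter_upwards [hN] with y hy using hPeq y hy⟩
  filter_upwards [hτN, hne] with y hy hyne
  have hyN : y ∈ N := mem_of_mem_nhds hy
  have hheight : ∀ z ∈ N, sectionHeight ℓ φ x₀ V (z, τ z) = 0 := fun z hz =>
    (hℓ _).2 (hret z hz).2.1.1.2.1
  obtain ⟨θ, hθ, hθy, hθeq⟩ :=
    hφ.exists_crossing_time hD hr hf (hret y hyN).1 (hheight y hyN) hyne
  have hτy : ContDiffAt ℝ r τ y := by
    refine hθ.congr_of_eventuallyEq ?_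
    have h1 : ContinuousAt (fun z => (z, τ z)) y := continuousAt_id.prodMk (hτ.continuousAt hy)
    filter_upwards [h1.eventually hθeq, hy] with z hz hzN
    exact (hz.1 (hheight z hzN)).symm
  refine ⟨hτy, ContDiffAt.congr_of_eventuallyEq ?_
    (by filter_upwards [hy] with z hz using hPeq z hz)⟩
  have h2 : ContDiffAt ℝ r (fun z : V => φ (τ z) (x₀ + z)) y :=
    ContDiffAt.comp y (f := fun z : V => (z, τ z)) (g := fun p : V × ℝ => φ p.2 (x₀ + p.1))
      (hφ.contDiffAt_add hD hr hf (hret y hyN).1 _) (contDiffAt_id.prodMk hτy)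
  exact (projAlong ℓ hℓ hℓf).contDiff.contDiffAt.comp y (h2.sub contDiffAt_const)

theorem IsPoincareMap.apply_zero (hT : φ T x₀ = x₀) {τ : V → ℝ} {P : V → V}
    (hP : IsPoincareMap φ D x₀ T V τ P) : P 0 = 0 := by
  obtain ⟨N, hN, W, hW, hτ, hτ0, hret⟩ := hP
  have h := (hret 0 (mem_of_mem_nhds hN)).2.2
  simpa [hτ0, hT] using h

/-- Moving the initial point along its orbit shows that the monodromy operator fixes the
velocity. -/
theorem IsFlowOn.fderiv_period_apply (hD : IsOpen D) (hf : ContDiffOn ℝ 1 f D)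
    (hφ : IsFlowOn f D φ) (hx₀ : x₀ ∈ D) {T : ℝ} (hT : φ T x₀ = x₀) :
    fderiv ℝ (φ T) x₀ (f x₀) = f x₀ := by
  have h0 : φ 0 x₀ = x₀ := hφ.zero x₀ hx₀
  have h1 : HasDerivAt (fun s => φ s x₀) (f x₀) 0 := by
    simpa only [h0] using hφ.isIntegralCurve x₀ hx₀ 0
  have h2 : ContDiffAt ℝ 1 (φ T) x₀ :=
    ContDiffAt.comp x₀ (f := fun y => (T, y)) (hφ.contDiffAt hD le_rfl hf hx₀ T) (by fun_prop)
  have h3 : HasFDerivAt (φ T) (fderiv ℝ (φ T) x₀) (φ 0 x₀) := by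
    rw [h0]; exact (h2.differentiableAt one_ne_zero).hasFDerivAt
  refine (h3.comp_hasDerivAt (0 : ℝ) h1).unique ?_
  have h4 : φ T ∘ (fun s => φ s x₀) = fun s => φ s x₀ := by
    ext1 s
    rw [Function.comp_apply, ← hφ.add hD hf hx₀, add_comm, hφ.add hD hf hx₀, hT]
  rw [h4]
  exact h1

/-- The derivative of a Poincaré map is the compression of the monodromy operator to `V` along the
velocity: the derivative of the return time contributes a multiple of the velocity only. -/
theorem IsPoincareMap.fderiv_zero (hD : IsOpen D) (hf : ContDiffOn ℝ 1 f D)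
    (hφ : IsFlowOn f D φ) (hx₀ : x₀ ∈ D) {T : ℝ} (hT : φ T x₀ = x₀)
    (hℓ : ∀ v, ℓ v = 0 ↔ v ∈ V) (hℓf : ℓ (f x₀) = 1) {τ : V → ℝ} {P : V → V}
    (hP : IsPoincareMap φ D x₀ T V τ P) :
    fderiv ℝ P 0 = projAlong ℓ hℓ hℓf ∘L fderiv ℝ (φ T) x₀ ∘L V.subtypeL := by
  obtain ⟨hreg, hPeq⟩ := hP.eventually_contDiffAt hD le_rfl hf hφ hx₀ hT hℓ hℓf
  have hτ0 : τ 0 = T := by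
    obtain ⟨N, hN, W, hW, hτ, hτ0, hret⟩ := hP
    exact hτ0
  have hτ' := (hreg.self_of_nhds.1.differentiableAt one_ne_zero).hasFDerivAt
  have hΦ := ((hφ.contDiffAt hD le_rfl hf hx₀ T).differentiableAt one_ne_zero).hasFDerivAt
  set Φ' := fderiv ℝ (fun p : ℝ × EuclideanSpace ℝ (Fin n) => φ p.1 p.2) (T, x₀)
  have hinr : fderiv ℝ (φ T) x₀ = Φ' ∘L .inr ℝ _ _ :=
    (hΦ.comp x₀ (hasFDerivAt_prodMk_right T x₀)).fderiv
  have hinl : Φ' (1, 0) = f x₀ := by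
    have h0 : HasFDerivAt (fun t => φ t x₀) _ T :=
      HasFDerivAt.comp (g := fun p : ℝ × EuclideanSpace ℝ (Fin n) => φ p.1 p.2)
        (f := fun t => (t, x₀)) T hΦ (hasFDerivAt_prodMk_left T x₀)
    have h1 := h0.hasDerivAt.unique (hφ.isIntegralCurve x₀ hx₀ T)
    simpa [hT] using h1
  have hpath : HasFDerivAt (fun y : V => (τ y, x₀ + (y : EuclideanSpace ℝ (Fin n))))
      ((fderiv ℝ τ 0).prod V.subtypeL) 0 := hτ'.prodMk (V.subtypeL.hasFDerivAt.const_add x₀)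
  have hΦ0 : HasFDerivAt (fun p : ℝ × EuclideanSpace ℝ (Fin n) => φ p.1 p.2) Φ'
      (τ 0, x₀ + ((0 : V) : EuclideanSpace ℝ (Fin n))) := by simpa [hτ0] using hΦ
  have hfd := ((projAlong ℓ hℓ hℓf).hasFDerivAt.comp 0
    ((hΦ0.comp 0 hpath).sub_const x₀)).congr_of_eventuallyEq hPeq
  rw [hfd.fderiv, hinr]
  ext1 y
  have hsplit : Φ' (fderiv ℝ τ 0 y, (y : EuclideanSpace ℝ (Fin n))) =
      fderiv ℝ τ 0 y • f x₀ + Φ' (0, (y : EuclideanSpace ℝ (Fin n))) := by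
    rw [← hinl, ← map_smul, ← map_add]
    simp
  have hπf : projAlong ℓ hℓ hℓf (f x₀) = 0 := by
    ext1; simp [coe_projAlong, hℓf]
  simp [hsplit, hπf]

end Return

section Existence

variable {n : ℕ} {f : EuclideanSpace ℝ (Fin n) → EuclideanSpace ℝ (Fin n)}
  {D : Set (EuclideanSpace ℝ (Fin n))}
  {φ : ℝ → EuclideanSpace ℝ (Fin n) → EuclideanSpace ℝ (Fin n)}
  {V : Submodule ℝ (EuclideanSpace ℝ (Fin n))} {x₀ : EuclideanSpace ℝ (Fin n)}
  {ℓ : EuclideanSpace ℝ (Fin n) →L[ℝ] ℝ}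

/-- Orbits that start on the hyperplane near `x₀` leave it at once, uniformly. -/
theorem IsFlowOn.exists_forall_sectionHeight_pos (hD : IsOpen D) (hf : ContDiffOn ℝ 1 f D)
    (hφ : IsFlowOn f D φ) (hx₀ : x₀ ∈ D) (hℓ : ∀ v, ℓ v = 0 ↔ v ∈ V) (hℓf : ℓ (f x₀) = 1) :
    ∃ δ > 0, ∀ᶠ y in 𝓝 (0 : V), ∀ t, 0 < t → t < δ → 0 < sectionHeight ℓ φ x₀ V (y, t) := by
  have hx₀' : x₀ + ((0 : V) : EuclideanSpace ℝ (Fin n)) ∈ D := by simpa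
  have h1 : ContinuousAt (fun p : V × ℝ => ℓ (f (φ p.2 (x₀ + p.1)))) (0, 0) :=
    ℓ.continuous.continuousAt.comp (ContinuousAt.comp
      (f := fun p : V × ℝ => φ p.2 (x₀ + p.1))
      (hf.continuousOn.continuousAt (hD.mem_nhds (hφ.mem _ hx₀' _)))
      (hφ.contDiffAt_add hD le_rfl hf hx₀' 0).continuousAt)
  have h2 : ∀ᶠ p : V × ℝ in 𝓝 (0, 0), 0 < ℓ (f (φ p.2 (x₀ + p.1))) :=
    h1.eventually_const_lt (by simp [hφ.zero x₀ hx₀, hℓf])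
  rw [nhds_prod_eq, Filter.eventually_prod_iff] at h2
  obtain ⟨p, hp, q, hq, hpq⟩ := h2
  obtain ⟨δ, hδ, hq⟩ := Metric.eventually_nhds_iff_ball.1 hq
  refine ⟨δ, hδ, ?_⟩
  filter_upwards [hp, eventually_add_mem hD hx₀] with y hy hyD t ht0 htδ
  have hder := hφ.hasDerivAt_sectionHeight (ℓ := ℓ) (V := V) hyD
  have hmono : StrictMonoOn (fun t => sectionHeight ℓ φ x₀ V (y, t)) (Icc 0 t) := by
    refine strictMonoOn_of_deriv_pos (convex_Icc 0 t)
      (fun s _ => (hder s).continuousAt.continuousWithinAt) fun s hs => ?_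
    rw [interior_Icc] at hs
    rw [(hder s).deriv]
    refine hpq hy (hq s ?_)
    rw [Real.ball_eq_Ioo]
    exact ⟨by linarith [hs.1], by linarith [hs.2]⟩
  have h3 := hmono (left_mem_Icc.2 ht0.le) (right_mem_Icc.2 ht0.le) ht0
  have h4 : sectionHeight ℓ φ x₀ V (y, 0) = 0 := by
    rw [sectionHeight, hφ.zero _ hyD, add_sub_cancel_left, (hℓ _).2 y.2]
  simpa only [h4] using h3

/-- If `T` is the least period, orbits that start near `x₀` avoid a neighborhood of `x₀` at all
times of `(0, T)` that stay away from the end points. -/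
theorem IsFlowOn.exists_nhds_forall_notMem (hD : IsOpen D) (hf : ContDiffOn ℝ 1 f D)
    (hφ : IsFlowOn f D φ) (hx₀ : x₀ ∈ D) {T δ : ℝ} (hδ : 0 < δ) (hT : IsLeastPeriod φ x₀ T) :
    ∃ W ∈ 𝓝 x₀, ∀ᶠ y : V in 𝓝 0, ∀ t ∈ Icc δ (T - δ), φ t (x₀ + y) ∉ W := by
  have hne : ∀ t ∈ Icc δ (T - δ), φ t x₀ ≠ x₀ := fun t ht =>
    hT t (by linarith [ht.1]) (by linarith [ht.2])
  have hclosed : IsClosed ((fun t => φ t x₀) '' Icc δ (T - δ)) :=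
    (isCompact_Icc.image (hφ.isIntegralCurve x₀ hx₀).continuous).isClosed
  have hnot : x₀ ∉ (fun t => φ t x₀) '' Icc δ (T - δ) := by
    rintro ⟨t, ht, h⟩
    exact hne t ht h
  obtain ⟨ρ, hρ, hball⟩ := Metric.nhds_basis_closedBall.mem_iff.1
    (hclosed.isOpen_compl.mem_nhds hnot)
  refine ⟨Metric.closedBall x₀ ρ, Metric.closedBall_mem_nhds x₀ hρ, ?_⟩
  refine isCompact_Icc.eventually_forall_of_forall_eventually fun t ht => ?_
  refine (hφ.contDiffAt_add hD le_rfl hf (by simpa) t).continuousAt.eventually_mem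
    (s := (Metric.closedBall x₀ ρ)ᶜ) (Metric.isClosed_closedBall.isOpen_compl.mem_nhds ?_)
  intro hmem
  exact hball (by simpa using hmem) ⟨t, ht, rfl⟩

/-- If `T` is the least period, the crossing time near `T` is the first return time to a small piece
of the hyperplane: early on orbits have left the hyperplane, later they are far from `x₀`, and near
`T` they cross the hyperplane only once. -/
theorem IsFlowOn.exists_isPoincareMap (hD : IsOpen D) (hf : ContDiffOn ℝ 1 f D)
    (hφ : IsFlowOn f D φ) (hx₀ : x₀ ∈ D) {T : ℝ} (hTpos : 0 < T) (hT : φ T x₀ = x₀)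
    (hleast : IsLeastPeriod φ x₀ T) (hℓ : ∀ v, ℓ v = 0 ↔ v ∈ V) (hℓf : ℓ (f x₀) = 1) :
    ∃ τ P, IsPoincareMap φ D x₀ T V τ P := by
  have hx₀' : x₀ + ((0 : V) : EuclideanSpace ℝ (Fin n)) ∈ D := by simpa
  obtain ⟨τ, hτ, hτ0, hτeq⟩ := hφ.exists_crossing_time (V := V) (ℓ := ℓ) hD le_rfl hf hx₀' (t := T)
    (by simp [sectionHeight, hT]) (by simp [hT, hℓf])
  obtain ⟨δ₀, hδ₀, hpos⟩ := hφ.exists_forall_sectionHeight_pos hD hf hx₀ hℓ hℓf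
  rw [nhds_prod_eq, Filter.eventually_prod_iff] at hτeq
  obtain ⟨p, hp, q, hq, hpq⟩ := hτeq
  obtain ⟨δ₁, hδ₁, hq⟩ := Metric.eventually_nhds_iff_ball.1 hq
  obtain ⟨δ, hδ, hδ0', hδ1', hδT⟩ : ∃ δ > 0, δ < δ₀ ∧ δ < δ₁ ∧ δ < T := by
    obtain ⟨δ, h1, h2⟩ := exists_between (lt_min hδ₀ (lt_min hδ₁ hTpos))
    exact ⟨δ, h1, by simpa using h2⟩
  have hq' : ∀ t, T - δ < t → t < T + δ → q t := fun t h1 h2 => hq t (by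
    rw [Real.ball_eq_Ioo]; exact ⟨by linarith, by linarith⟩)
  obtain ⟨W, hW, havoid⟩ := hφ.exists_nhds_forall_notMem (V := V) hD hf hx₀ hδ hleast
  have hτc : ContinuousAt τ 0 := hτ.continuousAt
  have hτnear : ∀ᶠ y in 𝓝 (0 : V), τ y ∈ Ioo (T - δ) (T + δ) :=
    hτc.eventually_mem (Ioo_mem_nhds (by linarith) (by linarith))
  have hτW : ∀ᶠ y in 𝓝 (0 : V), φ (τ y) (x₀ + y) ∈ W := by
    have h1 : ContinuousAt (fun p : V × ℝ => φ p.2 (x₀ + p.1)) (0, τ 0) :=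
      (hφ.contDiffAt_add hD le_rfl hf hx₀' _).continuousAt
    have h2 : ContinuousAt (fun y : V => φ (τ y) (x₀ + y)) 0 :=
      ContinuousAt.comp (f := fun y : V => (y, τ y)) h1 (continuousAt_id.prodMk hτc)
    exact h2.eventually_mem (by simpa [hτ0, hT] using hW)
  have hgood := (((hτ.eventually (by simp)).and (eventually_add_mem hD hx₀)).and
    (hpos.and hp)).and (havoid.and (hτnear.and hτW))
  refine ⟨τ, fun y => projAlong ℓ hℓ hℓf (φ (τ y) (x₀ + y) - x₀), _, hgood, W, hW,
    fun y hy => hy.1.1.1.continuousAt.continuousWithinAt, hτ0, ?_⟩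
  rintro y ⟨⟨⟨-, hyD⟩, hypos, hyp⟩, hyavoid, hynear, hyW⟩
  have hcross : sectionHeight ℓ φ x₀ V (y, τ y) = 0 :=
    (hpq hyp (hq' _ hynear.1 hynear.2)).2 rfl
  refine ⟨hyD, ⟨⟨by linarith [hynear.1], (hℓ _).1 hcross, hyW⟩, ?_⟩, ?_⟩
  · rintro t ⟨ht0, htV, htW⟩
    have ht : sectionHeight ℓ φ x₀ V (y, t) = 0 := (hℓ _).2 htV
    by_contra! hlt
    rcases lt_or_ge t δ with h1 | h1
    · exact (hypos t ht0 (h1.trans hδ0')).ne' ht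
    rcases le_or_gt t (T - δ) with h2 | h2
    · exact hyavoid t ⟨h1, h2⟩ htW
    · exact hlt.ne' ((hpq hyp (hq' t h2 (hlt.trans hynear.2))).1 ht)
  · have h : ℓ (φ (τ y) (x₀ + y) - x₀) = 0 := hcross
    rw [coe_projAlong, h]
    simp

end Existence

/-! ### Poincaré maps and characteristic multipliers -/

theorem mainTheorem11 (n : ℕ) (D : Set (EuclideanSpace ℝ (Fin n))) (hD : IsOpen D)
    (r : WithTop ℕ∞) (hr : 1 ≤ r)
    (f : EuclideanSpace ℝ (Fin n) → EuclideanSpace ℝ (Fin n)) (hf : ContDiffOn ℝ r f D)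
    (φ : ℝ → EuclideanSpace ℝ (Fin n) → EuclideanSpace ℝ (Fin n)) (hφ : IsFlowOn f D φ)
    (γ : ℝ → EuclideanSpace ℝ (Fin n)) (T : ℝ) (hγ : IsPeriodicSolution f D γ T)
    (V : Submodule ℝ (EuclideanSpace ℝ (Fin n))) (hV : IsTransverseHyperplane γ V) :
    (∃ U, IsPrincipalSolution (fun t => fderiv ℝ f (γ t)) U) ∧
    (IsLeastPeriod φ (γ 0) T → ∃ τ P, IsPoincareMap φ D (γ 0) T V τ P) ∧
    ∀ U, IsPrincipalSolution (fun t => fderiv ℝ f (γ t)) U →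
    ∀ τ P, IsPoincareMap φ D (γ 0) T V τ P →
      (∃ N ∈ 𝓝 (0 : V), ContDiffOn ℝ r P N) ∧
      P 0 = 0 ∧
      complexEigenvalues (U T : EuclideanSpace ℝ (Fin n) →ₗ[ℝ] EuclideanSpace ℝ (Fin n)) =
        1 ::ₘ complexEigenvalues (fderiv ℝ P 0 : V →ₗ[ℝ] V) := by
  have hf1 : ContDiffOn ℝ 1 f D := hf.of_le hr
  have hx₀ : γ 0 ∈ D := hγ.mem 0
  have hγφ : (fun t => φ t (γ 0)) = γ := (hφ.isIntegralCurve _ hx₀).eq_of_mem hD hf1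
    (hφ.mem _ hx₀) hγ.isIntegralCurve hγ.mem (t₀ := 0) (hφ.zero _ hx₀)
  have hT : φ T (γ 0) = γ 0 := by
    rw [congrFun hγφ T, ← hγ.periodic 0, zero_add]
  obtain ⟨ℓ, hℓ, hℓf⟩ := hV.exists_dual
  rw [(hγ.isIntegralCurve 0).deriv] at hℓf
  have hW := hφ.isPrincipalSolution_fderiv hD hf1 hx₀
  simp only [congrFun hγφ] at hW
  refine ⟨⟨_, hW⟩, fun hleast =>
    hφ.exists_isPoincareMap hD hf1 hx₀ hγ.pos hT hleast hℓ hℓf, fun U hU τ P hP => ?_⟩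
  refine ⟨⟨_, (hP.eventually_contDiffAt hD hr hf hφ hx₀ hT hℓ hℓf).1,
    fun y hy => hy.2.contDiffWithinAt⟩, hP.apply_zero hT, ?_⟩
  have hA : Continuous fun t => fderiv ℝ f (γ t) :=
    (hf1.continuousOn_fderiv_of_isOpen hD le_rfl).comp_continuous hγ.isIntegralCurve.continuous
      hγ.mem
  rw [hU.eq_of_nonneg hA hW hγ.pos.le, hP.fderiv_zero hD hf1 hφ hx₀ hT hℓ hℓf]
  exact complexEigenvalues_eq_cons ℓ (fun v hv => (hℓ v).2 hv) (projAlong ℓ hℓ hℓf) hℓf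
    (coe_projAlong hℓ hℓf) _ (hφ.fderiv_period_apply hD hf1 hx₀ hT)
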